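/- A reduced crossed complex $C$ (one with a single object $*$) consists of groups $C_n$ ($n\ge 1$), abelian for $n\ge 3$, right actions of $C_1$ on every $C_n$ (conjugation for $n=1$) and $C_1$-equivariant homomorphisms $\delta_n : C_n\to C_{n-1}$ ($n\ge 2$) with $\delta_n\delta_{n+1}=0$, such that $\delta_2$ is a crossed module ($a^{\delta_2 b}=-b+a+b$) and $\delta_2C_2$ acts trivially on $C_n$ for $n\ge 3$. Put $\pi_1C=\operatorname{Coker}\delta_2$. $C$ is aspherical if $H_n(C)=\operatorname{Ker}\delta_n/\operatorname{Im}\delta_{n+1}=0$ for all $n\ge 2$. $F$ is free if it is obtained from a point by attaching cells in order of increasing dimension, that is, it has a basis on which $F_1$ is a free group, $F_2$ a free crossed $F_1$-module, and each $F_n$ ($n\ge3$) a free $\pi_1F$-module. For a group $G$, $\mathbb K(G,1)$ is the crossed complex that is $G$ in dimension $1$ and trivial elsewhere. For reduced crossed complexes $F,C$, the crossed complex $\mathrm{CRS}_*(F,C)$, over a groupoid, has as objects the morphisms $F\to C$. For $m\ge 1$, an $m$-fold pointed homotopy over $f$ is a family of maps $H:F_n\to C_{n+m}$ ($n\ge1$)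 with $H(b+b')=H(b)^{f(b')}+H(b')$ on $F_1$ and, on $F_n$ for $n\ge2$, $H(b+b')=H(b)+H(b')$ and $H(b^{a})=H(b)^{f(a)}$ for $a \in F_1$. The arrows $f^-\to f$ of $\mathrm{CRS}_*(F,C)$ are the $1$-fold homotopies $H$ over $f$ with $f^-(b)=f(b)+\delta H(b)$ on $F_1$ and $f^-(b)=f(b)+H(\delta b)+\delta H(b)$ on $F_n$, $n\ge 2$. The composite of $H:f\to g$ and $H':g\to h$ is $b\mapsto H'(b)+H(b)$. For $m\ge2$ the group in dimension $m$ at $f$ consists of the $m$-fold homotopies over $f$ under addition of values, with boundary $(\delta H)(b)=\delta(H(b))$ on $F_1$ and $(\delta H)(b)=\delta(H(b))+(-1)^{m+1}H(\delta b)$ on $F_n$, $n\ge2$; arrows act by changing the base morphism and keeping the values. Write $[F,C]_*=\pi_0\mathrm{CRS}_*(F,C)$ for its set of components. For a crossed complex $E$ and an object $x$, $\pi_1(E,x)$ is the vertex group at $x$ of $\operatorname{Coker}\delta_2$, and $\pi_n(E,x)=H_n(E,x)$ for $n\ge2$. **Proposition 2.9.** Let $F$ and $C$ be reduced crossed complexes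 with $F$ free and $C$ aspherical. Let $G=\pi_1C$ and let $p:C\to\mathbb K(G,1)$ be the natural morphism, given by the quotient map $C_1\to\pi_1C$ in dimension $1$. Then the map induced by $p$ and the map sending the class of $h:F\to\mathbb K(G,1)$ to the induced homomorphism $\pi_1F\to G$ are bijections $$\pi_0\mathrm{CRS}_*(F,C)=[F,C]_*\;\xrightarrow{\ p_*\ }\;[F,\mathbb K(G,1)]_*\;\xrightarrow{\ \ }\;\operatorname{Hom}(\pi_1F,\pi_1C),$$ whose composite sends the class of $f$ to $\pi_1(f)$. Moreover, for every morphism $f:F\to C$ and every $n\ge1$, $$\pi_n(\mathrm{CRS}_*(F,C),f)=0.$$ -/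

import Mathlib

open CategoryTheory

universe u

/-! ### Reduced crossed complexes -/

/-- A reduced crossed complex (one object). `G n` is the group in dimension `n + 1`, and
`act n g a` is `a ^ g`, the right action of the group in dimension one; in dimension one itself
this is conjugation. -/
structure ReducedCrossedComplex where
  G : ℕ → Type u
  grp : ∀ n, Group (G n)
  /-- the boundary from dimension `n + 2` to dimension `n + 1` -/
  δ : ∀ n, G (n + 1) →* G n
  act : ∀ n, G 0 → G n →* G n
  act_one : ∀ n a, act n 1 a = a
  act_mul : ∀ n g h a, act n (g * h) a = act n h (act n g a)
  act_zero : ∀ g a, act 0 g a = g⁻¹ * a * g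
  /-- groups in dimensions `≥ 3` are abelian -/
  comm : ∀ n (a b : G (n + 2)), a * b = b * a
  δ_act : ∀ n g a, δ n (act (n + 1) g a) = act n g (δ n a)
  /-- the crossed module law in dimension two -/
  peiffer : ∀ a b : G 1, act 1 (δ 0 b) a = b⁻¹ * a * b
  /-- boundaries of elements of dimension two act trivially in dimensions `≥ 3` -/
  act_boundary : ∀ n (b : G 1) (a : G (n + 2)), act (n + 2) (δ 0 b) a = a
  δ_δ : ∀ n a, δ n (δ (n + 1) a) = 1

namespace ReducedCrossedComplex

attribute [instance] ReducedCrossedComplex.grp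

/-- Morphisms of reduced crossed complexes (automatically pointed). -/
@[ext]
structure Hom (F C : ReducedCrossedComplex.{u}) where
  map : ∀ n, F.G n →* C.G n
  map_δ : ∀ n a, map n (F.δ n a) = C.δ n (map (n + 1) a)
  map_act : ∀ n g a, map n (F.act n g a) = C.act n (map 0 g) (map n a)

/-- Composition: first `f`, then `p`. -/
def Hom.comp {F C D : ReducedCrossedComplex.{u}} (p : Hom C D) (f : Hom F C) : Hom F D where
  map n := (p.map n).comp (f.map n)
  map_δ n a := by simp [f.map_δ, p.map_δ]
  map_act n g a := by simp [f.map_act, p.map_act]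

instance normal_range_δ (C : ReducedCrossedComplex.{u}) : (C.δ 0).range.Normal where
  conj_mem := by
    rintro _ ⟨a, rfl⟩ g
    exact ⟨C.act 1 g⁻¹ a, by rw [C.δ_act, C.act_zero, inv_inv]⟩

/-- The fundamental group `π₁ C = Coker δ₂`. -/
abbrev π₁ (C : ReducedCrossedComplex.{u}) : Type u := C.G 0 ⧸ (C.δ 0).range

/-- The homomorphism `π₁ F → π₁ C` induced by a morphism. -/
def Hom.π₁Map {F C : ReducedCrossedComplex.{u}} (f : Hom F C) : π₁ F →* π₁ C :=
  QuotientGroup.map _ _ (f.map 0) (by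
    rintro _ ⟨a, rfl⟩
    exact ⟨f.map 1 a, (f.map_δ 0 a).symm⟩)

/-- The homology group of `C` in dimension `n + 2`. -/
abbrev H (C : ReducedCrossedComplex.{u}) (n : ℕ) : Type u :=
  (C.δ n).ker ⧸ (C.δ (n + 1)).range.subgroupOf (C.δ n).ker

/-- `C` is aspherical: its homology vanishes in all dimensions `≥ 2`.
(A reduced crossed complex is connected.) -/
def IsAspherical (C : ReducedCrossedComplex.{u}) : Prop := ∀ n, Subsingleton (C.H n)

/-! ### Free reduced crossed complexes -/

/-- `μ : M → P` with the right action `act p m = m ^ p` of `P` on `M` is a crossed module. -/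
structure IsCrossedModule {M P : Type u} [Group M] [Group P] (μ : M →* P) (act : P → M →* M) :
    Prop where
  act_one : ∀ a, act 1 a = a
  act_mul : ∀ g h a, act (g * h) a = act h (act g a)
  map_act : ∀ g a, μ (act g a) = g⁻¹ * μ a * g
  peiffer : ∀ a b, act (μ b) a = b⁻¹ * a * b

/-- A free basis of a reduced crossed complex `F`: the group in dimension one is free,
in dimension two we have a free crossed module over it, and in each dimension `≥ 3` a free
`π₁ F`-module. -/
structure FreeBasis (F : ReducedCrossedComplex.{u}) where
  /-- the set of basis elements (cells) of dimension `n + 1` -/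
  X : ℕ → Type u
  ι : ∀ n, X n → F.G n
  free_one : Function.Bijective (FreeGroup.lift (ι 0))
  free_two : ∀ (M P : Type u) [Group M] [Group P] (μ : M →* P) (act : P → M →* M),
    IsCrossedModule μ act → ∀ (φ : F.G 0 →* P) (v : X 1 → M),
      (∀ x, μ (v x) = φ (F.δ 0 (ι 1 x))) →
      ∃! ψ : F.G 1 →* M, (∀ b, μ (ψ b) = φ (F.δ 0 b)) ∧
        (∀ g b, ψ (F.act 1 g b) = act (φ g) (ψ b)) ∧ ∀ x, ψ (ι 1 x) = v x
  free_ge_three : ∀ (n : ℕ) (A : Type u) [CommGroup A] (act : π₁ F → A →* A),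
    (∀ a, act 1 a = a) → (∀ g h a, act (g * h) a = act h (act g a)) →
      ∀ v : X (n + 2) → A,
      ∃! ψ : F.G (n + 2) →* A,
        (∀ (g : F.G 0) b, ψ (F.act (n + 2) g b) = act (QuotientGroup.mk g) (ψ b)) ∧
          ∀ x, ψ (ι (n + 2) x) = v x

/-- `F` is free: it is obtained from a point by attaching cells in order of dimension. -/
def IsFree (F : ReducedCrossedComplex.{u}) : Prop := Nonempty (FreeBasis F)

/-! ### The crossed complex `K(G, 1)` -/

/-- `G` in index `0`, trivial in all other indices. -/
def KObj (G : Type u) : ℕ → Type u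
  | 0 => G
  | _ + 1 => PUnit

instance KGroup (G : Type u) [Group G] : ∀ n, Group (KObj G n)
  | 0 => inferInstanceAs (Group G)
  | _ + 1 => inferInstanceAs (Group PUnit)

instance (G : Type u) (n : ℕ) : Subsingleton (KObj G (n + 1)) :=
  inferInstanceAs (Subsingleton PUnit)

/-- Conjugation in index `0`, trivial in all other indices. -/
def KAct (G : Type u) [Group G] : ∀ n, KObj G 0 → KObj G n →* KObj G n
  | 0, g => (MulAut.conj g⁻¹).toMonoidHom
  | _ + 1, _ => MonoidHom.id _

/-- `K(G, 1)`: the group `G` in dimension one, trivial in higher dimensions. -/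
def K (G : Type u) [Group G] : ReducedCrossedComplex.{u} where
  G := KObj G
  grp := KGroup G
  δ _ := 1
  act := KAct G
  act_one n a := by
    cases n with
    | zero => simp [KAct]
    | succ n => exact Subsingleton.elim _ _
  act_mul n g h a := by
    cases n with
    | zero => simp [KAct, mul_assoc]
    | succ n => exact Subsingleton.elim _ _
  act_zero g a := by simp [KAct]
  comm _ _ _ := Subsingleton.elim _ _
  δ_act n g a := by simp
  peiffer _ _ := Subsingleton.elim _ _
  act_boundary _ _ _ := Subsingleton.elim _ _
  δ_δ _ _ := rfl

instance (G : Type u) [Group G] (n : ℕ) : Subsingleton ((K G).G (n + 1)) :=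
  inferInstanceAs (Subsingleton (KObj G (n + 1)))

/-- The underlying maps of the natural morphism `C → K(π₁ C, 1)`. -/
def toKMap (C : ReducedCrossedComplex.{u}) : ∀ n, C.G n →* (K (π₁ C)).G n
  | 0 => QuotientGroup.mk' (C.δ 0).range
  | _ + 1 => 1

/-- The natural morphism `C → K(π₁ C, 1)`: the quotient map in dimension one. -/
def toK (C : ReducedCrossedComplex.{u}) : Hom C (K (π₁ C)) where
  map := C.toKMap
  map_δ n a := by
    cases n with
    | zero => exact (QuotientGroup.eq_one_iff _).2 ⟨a, rfl⟩
    | succ n => exact Subsingleton.elim _ _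
  map_act n g a := by
    cases n with
    | zero => rw [C.act_zero, (K (π₁ C)).act_zero, map_mul, map_mul, map_inv]
    | succ n => exact Subsingleton.elim _ _

/-- The homomorphism `π₁ F → G` induced by a morphism `F → K(G, 1)`. -/
def Hom.toπ₁Hom {F : ReducedCrossedComplex.{u}} {G : Type u} [Group G] (f : Hom F (K G)) :
    π₁ F →* G :=
  QuotientGroup.lift (M := G) (F.δ 0).range (f.map 0) (by
    rintro _ ⟨a, rfl⟩
    exact f.map_δ 0 a)

/-! ### Elementary consequences of the axioms -/

section Lemmas

variable (C : ReducedCrossedComplex.{u})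

theorem comm' {l : ℕ} (hl : 2 ≤ l) (a b : C.G l) : a * b = b * a := by
  obtain ⟨l, rfl⟩ := Nat.exists_eq_add_of_le' hl
  exact C.comm l a b

theorem act_boundary' {l : ℕ} (hl : 2 ≤ l) (b : C.G 1) (a : C.G l) :
    C.act l (C.δ 0 b) a = a := by
  obtain ⟨l, rfl⟩ := Nat.exists_eq_add_of_le' hl
  exact C.act_boundary l b a

/-- Boundaries commute with everything in dimensions `≥ 2`. -/
theorem δ_central (l : ℕ) (a : C.G (l + 2)) (b : C.G (l + 1)) :
    C.δ (l + 1) a * b = b * C.δ (l + 1) a := by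
  cases l with
  | zero =>
    have h := C.peiffer b (C.δ 1 a)
    rw [C.δ_δ 0 a, C.act_one] at h
    have h2 : C.δ 1 a * b = C.δ 1 a * ((C.δ 1 a)⁻¹ * b * C.δ 1 a) := by rw [← h]
    rw [h2]; group
  | succ l => exact C.comm l _ _

end Lemmas

/-! ### Homotopies and higher homotopies -/

/-- An `m`-fold (left) pointed homotopy over the base morphism `f : F → C`, where `m ≥ 1`: a map
of degree `m` which is an `f`-derivation in dimension one and an `f`-equivariant homomorphism in
dimensions `≥ 2`. It is trivial on the base point, so no data is needed in dimension zero. -/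
structure FoldHomotopy (m : ℕ) {F C : ReducedCrossedComplex.{u}} (f : Hom F C) where
  map : ∀ n l, n + m = l → F.G n → C.G l
  map_mul_zero : ∀ l h b b', map 0 l h (b * b') =
    C.act l (f.map 0 b') (map 0 l h b) * map 0 l h b'
  map_mul_succ : ∀ n l h b b', map (n + 1) l h (b * b') =
    map (n + 1) l h b * map (n + 1) l h b'
  map_act : ∀ n l h g b, map (n + 1) l h (F.act (n + 1) g b) =
    C.act l (f.map 0 g) (map (n + 1) l h b)

namespace FoldHomotopy

variable {F C D : ReducedCrossedComplex.{u}}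

@[ext]
theorem ext' {m : ℕ} {f : Hom F C} {A B : FoldHomotopy m f}
    (h : ∀ n l hl b, A.map n l hl b = B.map n l hl b) : A = B := by
  cases A; cases B
  congr 1
  funext n l hl b
  exact h n l hl b

/-- Composing a homotopy with a morphism `p : C → D`. -/
def postcomp {m : ℕ} {f : Hom F C} (p : Hom C D) (A : FoldHomotopy m f) :
    FoldHomotopy m (p.comp f) where
  map n l h b := p.map l (A.map n l h b)
  map_mul_zero l h b b' := by simp [A.map_mul_zero, p.map_act, Hom.comp]
  map_mul_succ n l h b b' := by simp [A.map_mul_succ]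
  map_act n l h g b := by simp [A.map_act, p.map_act, Hom.comp]

variable {m : ℕ} {f : Hom F C}

theorem map_one (A : FoldHomotopy m f) (n l h) : A.map n l h 1 = 1 := by
  cases n with
  | zero => simpa [C.act_one] using A.map_mul_zero l h 1 1
  | succ n => simpa using A.map_mul_succ n l h 1 1

theorem map_zero_inv (A : FoldHomotopy m f) (l h) (b : F.G 0) :
    A.map 0 l h b⁻¹ = C.act l (f.map 0 b)⁻¹ (A.map 0 l h b)⁻¹ := by
  have h1 := A.map_mul_zero l h b b⁻¹
  rw [mul_inv_cancel, map_one, _root_.map_inv] at h1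
  rw [_root_.map_inv]
  exact (inv_eq_of_mul_eq_one_right h1.symm).symm

theorem map_zero_conj (A : FoldHomotopy m f) (l h) (b g : F.G 0) :
    A.map 0 l h (g⁻¹ * b * g) =
      C.act l (f.map 0 (g⁻¹ * b * g)) (A.map 0 l h g)⁻¹ *
        C.act l (f.map 0 g) (A.map 0 l h b) * A.map 0 l h g := by
  rw [A.map_mul_zero, A.map_mul_zero, map_zero_inv, _root_.map_mul]
  congr 2
  simp only [← C.act_mul, _root_.map_mul, _root_.map_inv, mul_assoc]

/-- The group structure on `m`-fold homotopies over `f`, for `m ≥ 2`: addition of values. -/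
instance instCommGroup (k : ℕ) (f : Hom F C) : CommGroup (FoldHomotopy (k + 2) f) where
  mul A B :=
    { map := fun n l h b => A.map n l h b * B.map n l h b
      map_mul_zero := fun l h b b' => by
        have hl : 2 ≤ l := by omega
        rw [A.map_mul_zero, B.map_mul_zero, _root_.map_mul, mul_assoc, mul_assoc,
          ← mul_assoc (A.map 0 l h b'), C.comm' hl (A.map 0 l h b'), mul_assoc]
      map_mul_succ := fun n l h b b' => by
        have hl : 2 ≤ l := by omega
        rw [A.map_mul_succ, B.map_mul_succ, mul_assoc, mul_assoc,
          ← mul_assoc (A.map (n + 1) l h b'), C.comm' hl (A.map (n + 1) l h b'), mul_assoc]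
      map_act := fun n l h g b => by rw [A.map_act, B.map_act, _root_.map_mul] }
  one :=
    { map := fun _ _ _ _ => 1
      map_mul_zero := by simp
      map_mul_succ := by simp
      map_act := by simp }
  inv A :=
    { map := fun n l h b => (A.map n l h b)⁻¹
      map_mul_zero := fun l h b b' => by
        have hl : 2 ≤ l := by omega
        rw [A.map_mul_zero, mul_inv_rev, _root_.map_inv, C.comm' hl]
      map_mul_succ := fun n l h b b' => by
        have hl : 2 ≤ l := by omega
        rw [A.map_mul_succ, mul_inv_rev, C.comm' hl]
      map_act := fun n l h g b => by rw [A.map_act, _root_.map_inv] }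
  mul_assoc _ _ _ := ext' fun _ _ _ _ => mul_assoc _ _ _
  one_mul _ := ext' fun _ _ _ _ => one_mul _
  mul_one _ := ext' fun _ _ _ _ => mul_one _
  inv_mul_cancel _ := ext' fun _ _ _ _ => inv_mul_cancel _
  mul_comm _ _ := ext' fun n l h _ => C.comm' (show 2 ≤ l by omega) _ _

@[simp] theorem mul_map {k : ℕ} {f : Hom F C} (A B : FoldHomotopy (k + 2) f) (n l h b) :
    (A * B).map n l h b = A.map n l h b * B.map n l h b := rfl

@[simp] theorem one_map {k : ℕ} {f : Hom F C} (n l h b) :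
    (1 : FoldHomotopy (k + 2) f).map n l h b = 1 := rfl

/-- The maps underlying the boundary of an `(m + 1)`-fold homotopy `A`, for `m ≥ 1`:
`δ (A b)` in dimension one, `δ (A b) + (-1) ^ (m + 2) A (δ b)` in dimensions `≥ 2`. -/
def boundaryMap (A : FoldHomotopy (m + 1) f) : ∀ n l, n + m = l → F.G n → C.G l
  | 0, l, h, b => C.δ l (A.map 0 (l + 1) (by omega) b)
  | n + 1, l, h, b => C.δ l (A.map (n + 1) (l + 1) (by omega) b) *
      A.map n l (by omega) (F.δ n b) ^ ((-1 : ℤ) ^ (m + 2))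

/-- The composite of a homotopy of degree `≥ 2` with `δ` is additive. -/
theorem map_δ_mul (A : FoldHomotopy (m + 2) f) (n l h) (b b' : F.G (n + 1)) :
    A.map n l h (F.δ n (b * b')) = A.map n l h (F.δ n b) * A.map n l h (F.δ n b') := by
  have hl : 2 ≤ l := by omega
  rw [_root_.map_mul]
  cases n with
  | zero => rw [A.map_mul_zero, f.map_δ, C.act_boundary' hl]
  | succ n => rw [A.map_mul_succ]

theorem map_δ_act (A : FoldHomotopy (m + 2) f) (n l h) (g : F.G 0) (b : F.G (n + 1)) :
    A.map n l h (F.δ n (F.act (n + 1) g b)) =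
      C.act l (f.map 0 g) (A.map n l h (F.δ n b)) := by
  have hl : 2 ≤ l := by omega
  rw [F.δ_act]
  cases n with
  | zero =>
    rw [F.act_zero, map_zero_conj, ← F.act_zero, ← F.δ_act, f.map_δ, C.act_boundary' hl,
      C.comm' hl _ (C.act l _ _), mul_assoc, inv_mul_cancel, mul_one]
  | succ n => rw [A.map_act]

/-- The boundary of an `m`-fold homotopy, `m ≥ 2`, which is an `(m - 1)`-fold homotopy over the
same morphism. -/
def boundary (A : FoldHomotopy (m + 2) f) : FoldHomotopy (m + 1) f where
  map := A.boundaryMap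
  map_mul_zero l h b b' := by
    obtain rfl : l = m + 1 := by omega
    simp only [boundaryMap]
    rw [A.map_mul_zero, _root_.map_mul, C.δ_act]
  map_mul_succ n l h b b' := by
    have hl : 2 ≤ l := by omega
    simp only [boundaryMap]
    rw [A.map_mul_succ, map_δ_mul, _root_.map_mul, (show Commute _ _ from C.comm' hl _ _).mul_zpow,
      mul_assoc, mul_assoc]
    congr 1
    rw [← mul_assoc, C.comm' hl (C.δ l _), mul_assoc]
  map_act n l h g b := by
    simp only [boundaryMap]
    rw [A.map_act, map_δ_act, _root_.map_mul, C.δ_act, map_zpow]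

theorem boundary_mul {k : ℕ} (A B : FoldHomotopy (k + 3) f) :
    boundary (A * B) = boundary A * boundary B := by
  ext n l h b
  have hl : 2 ≤ l := by omega
  cases n with
  | zero => simp [boundary, boundaryMap]
  | succ n =>
    simp only [boundary, boundaryMap, mul_map, _root_.map_mul]
    rw [(show Commute _ _ from C.comm' hl _ _).mul_zpow, mul_assoc, mul_assoc]
    congr 1
    rw [← mul_assoc, C.comm' hl (C.δ l _), mul_assoc]

theorem boundary_boundaryMap (A : FoldHomotopy (m + 3) f) (n l h b) :
    A.boundary.boundaryMap n l h b = 1 := by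
  obtain ⟨l, rfl⟩ : ∃ k, l = k + 1 := ⟨n + m, by omega⟩
  match n with
  | 0 =>
    simp only [boundaryMap, boundary]
    simp [C.δ_δ]
  | 1 =>
    simp only [boundaryMap, boundary]
    rw [_root_.map_mul, C.δ_δ, map_zpow, one_mul, ← zpow_add]
    simp [pow_succ]
  | n + 2 =>
    simp only [boundaryMap, boundary]
    rw [_root_.map_mul, C.δ_δ, map_zpow, one_mul, F.δ_δ, map_one, one_zpow, mul_one, ← zpow_add]
    simp [pow_succ]

/-- Changing the base morphism of an `m`-fold homotopy, `m ≥ 2`, to one that agrees with it in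
dimension one up to boundaries; the values do not change. -/
def rebase {k : ℕ} {g : Hom F C} (hfg : ∀ b, ∃ c, f.map 0 b = g.map 0 b * C.δ 0 c)
    (A : FoldHomotopy (k + 2) f) : FoldHomotopy (k + 2) g where
  map := A.map
  map_mul_zero l h b b' := by
    obtain ⟨c, hc⟩ := hfg b'
    rw [A.map_mul_zero, hc, C.act_mul, C.act_boundary' (by omega)]
  map_mul_succ := A.map_mul_succ
  map_act n l h b b' := by
    obtain ⟨c, hc⟩ := hfg b
    rw [A.map_act, hc, C.act_mul, C.act_boundary' (by omega)]

end FoldHomotopy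

/-- The formula for the source morphism of a (1-fold) homotopy `A` with target `g`:
`g b + δ (A b)` in dimension one, `g b + A (δ b) + δ (A b)` in dimensions `≥ 2`. -/
def FoldHomotopy.source {F C : ReducedCrossedComplex.{u}} {g : Hom F C} (A : FoldHomotopy 1 g) :
    ∀ n, F.G n → C.G n
  | 0, b => g.map 0 b * C.δ 0 (A.map 0 1 rfl b)
  | n + 1, b => g.map (n + 1) b * A.map n (n + 1) rfl (F.δ n b) *
      C.δ (n + 1) (A.map (n + 1) (n + 2) rfl b)

/-- Pointed homotopies from `f` to `g`. -/
structure Homotopy {F C : ReducedCrossedComplex.{u}} (f g : Hom F C) where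
  toFold : FoldHomotopy 1 g
  source_eq : ∀ n b, f.map n b = toFold.source n b

namespace Homotopy

variable {F C D : ReducedCrossedComplex.{u}} {f g h : Hom F C}

theorem ext' {A B : Homotopy f g}
    (h : ∀ n l hl b, A.toFold.map n l hl b = B.toFold.map n l hl b) : A = B := by
  cases A; cases B
  congr 1
  exact FoldHomotopy.ext' h

theorem source_zero (A : Homotopy f g) (b : F.G 0) :
    f.map 0 b = g.map 0 b * C.δ 0 (A.toFold.map 0 1 rfl b) := A.source_eq 0 b

theorem source_succ (A : Homotopy f g) (n : ℕ) (b : F.G (n + 1)) :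
    f.map (n + 1) b = g.map (n + 1) b * A.toFold.map n (n + 1) rfl (F.δ n b) *
      C.δ (n + 1) (A.toFold.map (n + 1) (n + 2) rfl b) := A.source_eq (n + 1) b

/-- Actions through the source and the target agree in dimensions `≥ 3`. -/
theorem act_source (A : Homotopy f g) {l : ℕ} (hl : 2 ≤ l) (b : F.G 0) (c : C.G l) :
    C.act l (f.map 0 b) c = C.act l (g.map 0 b) c := by
  rw [A.source_zero, C.act_mul, C.act_boundary' hl]

/-- The constant homotopy. -/
def refl (f : Hom F C) : Homotopy f f where
  toFold :=
    { map := fun _ _ _ _ => 1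
      map_mul_zero := by simp
      map_mul_succ := by simp
      map_act := by simp }
  source_eq n b := by cases n <;> simp [FoldHomotopy.source]

/-- Composition of homotopies; on values, `b ↦ B b + A b`. -/
def trans (A : Homotopy f g) (B : Homotopy g h) : Homotopy f h where
  toFold :=
    { map := fun n l hl b => B.toFold.map n l hl b * A.toFold.map n l hl b
      map_mul_zero := fun l hl b b' => by
        obtain rfl : l = 1 := by omega
        rw [B.toFold.map_mul_zero, A.toFold.map_mul_zero, B.source_zero, C.act_mul, C.peiffer,
          _root_.map_mul]
        group
      map_mul_succ := fun n l hl b b' => by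
        have h2 : 2 ≤ l := by omega
        rw [B.toFold.map_mul_succ, A.toFold.map_mul_succ, mul_assoc, mul_assoc,
          ← mul_assoc (B.toFold.map (n + 1) l hl b'), C.comm' h2 (B.toFold.map (n + 1) l hl b'),
          mul_assoc]
      map_act := fun n l hl g b => by
        rw [B.toFold.map_act, A.toFold.map_act, B.act_source (by omega), _root_.map_mul] }
  source_eq n b := by
    cases n with
    | zero => simp [FoldHomotopy.source, A.source_zero, B.source_zero, mul_assoc]
    | succ n =>
      simp only [FoldHomotopy.source, A.source_succ, B.source_succ, _root_.map_mul]
      simp only [mul_assoc]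
      rw [← mul_assoc (C.δ (n + 1) (B.toFold.map _ _ _ _)), C.δ_central n]
      simp only [mul_assoc]

/-- The inverse homotopy. -/
def symm (A : Homotopy f g) : Homotopy g f where
  toFold :=
    { map := fun n l hl b => (A.toFold.map n l hl b)⁻¹
      map_mul_zero := fun l hl b b' => by
        obtain rfl : l = 1 := by omega
        rw [A.toFold.map_mul_zero, A.source_zero, C.act_mul, C.peiffer, _root_.map_inv]
        group
      map_mul_succ := fun n l hl b b' => by
        rw [A.toFold.map_mul_succ, mul_inv_rev, C.comm' (by omega)]
      map_act := fun n l hl g b => by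
        rw [A.toFold.map_act, A.act_source (by omega), _root_.map_inv] }
  source_eq n b := by
    cases n with
    | zero => simp [FoldHomotopy.source, A.source_zero]
    | succ n =>
      simp only [FoldHomotopy.source, A.source_succ, _root_.map_inv]
      rw [mul_assoc (g.map _ _), ← C.δ_central n]
      group

/-- Composing a homotopy with a morphism. -/
def postcomp (p : Hom C D) (A : Homotopy f g) : Homotopy (p.comp f) (p.comp g) where
  toFold := A.toFold.postcomp p
  source_eq n b := by
    cases n with
    | zero => simp [FoldHomotopy.source, FoldHomotopy.postcomp, Hom.comp, A.source_zero, p.map_δ]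
    | succ n =>
      simp [FoldHomotopy.source, FoldHomotopy.postcomp, Hom.comp, A.source_succ, p.map_δ]

/-- The boundary of a 2-fold homotopy over `f`, as a homotopy from `f` to `f`. -/
def ofBoundary (A : FoldHomotopy 2 f) : Homotopy f f where
  toFold := A.boundary
  source_eq n b := by
    match n with
    | 0 =>
      simp only [FoldHomotopy.source, FoldHomotopy.boundary, FoldHomotopy.boundaryMap]
      simp [C.δ_δ 0]
    | 1 =>
      simp only [FoldHomotopy.source, FoldHomotopy.boundary, FoldHomotopy.boundaryMap]
      simp [C.δ_δ 1]
    | n + 2 =>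
      simp only [FoldHomotopy.source, FoldHomotopy.boundary, FoldHomotopy.boundaryMap]
      simp [C.δ_δ (n + 2), F.δ_δ n, FoldHomotopy.map_one]

end Homotopy

/-- Morphisms and pointed homotopies form a groupoid. -/
instance homGroupoid (F C : ReducedCrossedComplex.{u}) : Groupoid (Hom F C) where
  Hom f g := Homotopy f g
  id f := Homotopy.refl f
  comp A B := A.trans B
  inv A := A.symm
  id_comp _ := Homotopy.ext' fun _ _ _ _ => mul_one _
  comp_id _ := Homotopy.ext' fun _ _ _ _ => one_mul _
  assoc _ _ _ := Homotopy.ext' fun _ _ _ _ => (mul_assoc _ _ _).symm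
  inv_comp _ := Homotopy.ext' fun _ _ _ _ => mul_inv_cancel _
  comp_inv _ := Homotopy.ext' fun _ _ _ _ => inv_mul_cancel _

end ReducedCrossedComplex

/-! ### Crossed complexes over groupoids -/

/-- A crossed complex over a groupoid. `Cell n x` is the group at the object `x` in
dimension `n + 2`, and `act n p a` is `a ^ p`. -/
structure CrossedComplex where
  Obj : Type u
  groupoid : Groupoid.{u} Obj
  Cell : ℕ → Obj → Type u
  grp : ∀ n x, Group (Cell n x)
  comm : ∀ n x (a b : Cell (n + 1) x), a * b = b * a
  act : ∀ n {x y : Obj}, (x ⟶ y) → Cell n x →* Cell n y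
  act_id : ∀ n x a, act n (𝟙 x) a = a
  act_comp : ∀ n {x y z : Obj} (p : x ⟶ y) (q : y ⟶ z) a,
    act n (p ≫ q) a = act n q (act n p a)
  /-- the boundary from dimension two to the vertex groups in dimension one -/
  δ₂ : ∀ x, Cell 0 x → (x ⟶ x)
  δ₂_mul : ∀ x a b, δ₂ x (a * b) = δ₂ x a ≫ δ₂ x b
  /-- the boundary from dimension `n + 3` to dimension `n + 2` -/
  δ : ∀ n x, Cell (n + 1) x →* Cell n x
  δ₂_act : ∀ {x y : Obj} (p : x ⟶ y) a, δ₂ y (act 0 p a) = Groupoid.inv p ≫ δ₂ x a ≫ p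
  δ_act : ∀ n {x y : Obj} (p : x ⟶ y) a, δ n y (act (n + 1) p a) = act n p (δ n x a)
  peiffer : ∀ x (a b : Cell 0 x), act 0 (δ₂ x b) a = b⁻¹ * a * b
  act_boundary : ∀ n x (b : Cell 0 x) (a : Cell (n + 1) x), act (n + 1) (δ₂ x b) a = a
  δ₂_δ : ∀ x a, δ₂ x (δ 0 x a) = 𝟙 x
  δ_δ : ∀ n x a, δ n x (δ (n + 1) x a) = 1

namespace CrossedComplex

attribute [instance] CrossedComplex.groupoid CrossedComplex.grp

variable (E : CrossedComplex.{u})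

/-- Two objects are in the same component if some arrow joins them. -/
def componentSetoid : Setoid E.Obj where
  r x y := Nonempty (x ⟶ y)
  iseqv := ⟨fun x => ⟨𝟙 x⟩, fun ⟨p⟩ => ⟨Groupoid.inv p⟩, fun ⟨p⟩ ⟨q⟩ => ⟨p ≫ q⟩⟩

/-- The set of components. -/
abbrev π₀ : Type u := Quotient E.componentSetoid

/-- `δ₂` as a homomorphism to the vertex group at `x`, with product `p * q = p ≫ q`. -/
def δ₂Hom (x : E.Obj) : letI := Groupoid.vertexGroup x; E.Cell 0 x →* (x ⟶ x) :=
  letI := Groupoid.vertexGroup x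
  MonoidHom.mk' (E.δ₂ x) (E.δ₂_mul x)

/-- The homotopy groups of `E` at `x` (the set of components for `n = 0`): the vertex group of
the cokernel of `δ₂` for `n = 1`, and the homology groups `Ker δ / Im δ` for `n ≥ 2`. -/
def π : ℕ → E.Obj → Type u
  | 0, _ => E.π₀
  | 1, x => letI := Groupoid.vertexGroup x; (x ⟶ x) ⧸ (E.δ₂Hom x).range
  | 2, x => letI := Groupoid.vertexGroup x
    (E.δ₂Hom x).ker ⧸ (E.δ 0 x).range.subgroupOf (E.δ₂Hom x).ker
  | n + 3, x => (E.δ n x).ker ⧸ (E.δ (n + 1) x).range.subgroupOf (E.δ n x).ker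

end CrossedComplex

namespace ReducedCrossedComplex

/-! ### The pointed internal hom -/

/-- The crossed complex `CRS_*(F, C)`: its objects are the morphisms `F → C`, its arrows are the
pointed homotopies, and its elements of dimension `m ≥ 2` at `f` are the `m`-fold pointed
homotopies over `f`. -/
def CRS (F C : ReducedCrossedComplex.{u}) : CrossedComplex.{u} where
  Obj := Hom F C
  groupoid := homGroupoid F C
  Cell n f := FoldHomotopy (n + 2) f
  grp n f := inferInstance
  comm n f A B := mul_comm A B
  act n {f g} P :=
    { toFun := FoldHomotopy.rebase fun b => ⟨_, Homotopy.source_zero P b⟩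
      map_one' := rfl
      map_mul' := fun _ _ => rfl }
  act_id _ _ _ := rfl
  act_comp _ _ _ _ _ _ _ := rfl
  δ₂ _ A := Homotopy.ofBoundary A
  δ₂_mul f A B := Homotopy.ext' fun n l h b => by
    change (A * B).boundaryMap n l h b = B.boundaryMap n l h b * A.boundaryMap n l h b
    obtain rfl : l = n + 1 := by omega
    cases n with
    | zero =>
      simp only [FoldHomotopy.boundaryMap, FoldHomotopy.mul_map, map_mul]
      exact C.δ_central 0 _ _
    | succ n =>
      simp only [FoldHomotopy.boundaryMap, FoldHomotopy.mul_map, map_mul]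
      rw [(show Commute _ _ from C.comm n _ _).mul_zpow,
        Commute.mul_mul_mul_comm (show Commute _ _ from C.comm n _ _)]
      exact C.comm n _ _
  δ n _ := MonoidHom.mk' FoldHomotopy.boundary FoldHomotopy.boundary_mul
  δ₂_act {f g} P A := Homotopy.ext' fun n l h b => by
    change A.boundaryMap n l h b =
      (P.toFold.map n l h b * A.boundaryMap n l h b) * (P.toFold.map n l h b)⁻¹
    obtain rfl : l = n + 1 := by omega
    cases n with
    | zero =>
      simp only [FoldHomotopy.boundaryMap]
      rw [← C.δ_central 0, mul_assoc, mul_inv_cancel, mul_one]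
    | succ n => rw [C.comm n (P.toFold.map _ _ _ _), mul_assoc, mul_inv_cancel, mul_one]
  δ_act n {f g} P A := by
    apply FoldHomotopy.ext'
    intro n l h b
    cases n <;> rfl
  peiffer f A B := by
    rw [mul_comm B⁻¹, mul_assoc, inv_mul_cancel, mul_one]; rfl
  act_boundary _ _ _ _ := rfl
  δ₂_δ f A := Homotopy.ext' fun n l h b => A.boundary_boundaryMap n l h b
  δ_δ m f A := FoldHomotopy.ext' fun n l h b => A.boundary_boundaryMap n l h b

/-- `[F, C]_* = π₀ CRS_*(F, C)`, the set of pointed homotopy classes of morphisms `F → C`. -/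
abbrev HomotopyClasses (F C : ReducedCrossedComplex.{u}) : Type u := (CRS F C).π₀

/-- The class of a morphism. -/
def homotopyClass {F C : ReducedCrossedComplex.{u}} (f : Hom F C) : HomotopyClasses F C :=
  Quotient.mk _ f

/-- The map `[F, C]_* → [F, D]_*` induced by a morphism `p : C → D`. -/
def HomotopyClasses.postcomp (F : ReducedCrossedComplex.{u}) {C D : ReducedCrossedComplex.{u}}
    (p : Hom C D) : HomotopyClasses F C → HomotopyClasses F D :=
  Quotient.map p.comp fun _ _ ⟨A⟩ => ⟨Homotopy.postcomp p A⟩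

/-- The map `[F, K(G, 1)]_* → Hom(π₁ F, G)` which sends a class to its induced homomorphism. -/
def HomotopyClasses.toπ₁Hom (F : ReducedCrossedComplex.{u}) (G : Type u) [Group G] :
    HomotopyClasses F (K G) → (π₁ F →* G) :=
  Quotient.lift Hom.toπ₁Hom (by
    rintro f g ⟨A⟩
    apply QuotientGroup.monoidHom_ext
    ext b
    change f.map 0 b = g.map 0 b
    rw [Homotopy.source_zero A b]
    exact mul_one _)

end ReducedCrossedComplex

/-!
Morphisms, homotopies and higher homotopies from a free crossed complex to an aspherical one are
built dimension by dimension, by obstruction theory in which no obstruction survives.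

The components of all these objects are *twisted maps* over a homomorphism `φ : F.G 0 → C.G 0`:
derivations in dimension one, equivariant homomorphisms above (`IsTwisted`). Freeness is used in
two forms: a twisted map may be prescribed arbitrarily on the basis
(`FreeBasis.exists_twisted_zero`, and `FreeBasis.exists_twisted_succ` for targets of dimension
`≥ 3`), and it is determined by its values there (`FreeBasis.twisted_ext`). Together with
asphericity this shows that a twisted map on `F` with values in the cycles of `C` (the image of
`δ₂`, for values in dimension one) is `δ ∘ D` for a
twisted map `D` (`FreeBasis.exists_δ_comp_eq_zero`, `FreeBasis.exists_δ_comp_eq_succ`). In each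
construction the equation for the next component has the form `δ ∘ D = T`, where `T` is determined
by the previous component and its values are cycles because the previous equation holds.

* Every homomorphism `π₁ F → π₁ C` comes from a morphism (`FreeBasis.exists_π₁Map_eq`), and
  morphisms inducing the same homomorphism are homotopic (`FreeBasis.exists_homotopy`); so
  `[F, C]_* → Hom(π₁ F, π₁ C)` is bijective. For `K(G, 1)`, which has nothing above dimension one,
  the corresponding bijection is immediate (`toπ₁Hom_bijective`), and the first map of the
  proposition is then bijective as well.
* Every `m`-fold homotopy with trivial boundary is the boundary of an `(m + 1)`-fold one
  (`FreeBasis.exists_boundary_eq`). For `m = 1` a homotopy from `f` to itself is the same as a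
  1-fold homotopy with trivial boundary, so this covers `π₁` along with the higher groups.

The group of `C` in dimension two is not abelian. This matters only for the first step of a
homotopy (`isTwisted_obstruction_one`), where it is the centrality of cycles that makes `T` a
homomorphism.
-/

namespace ReducedCrossedComplex

variable {F C : ReducedCrossedComplex.{u}}

/-! ### Twisted maps -/

/-- The algebraic condition on the component in dimension `n + 1` of a fold homotopy over a
morphism with component `φ` in dimension one: a `φ`-derivation for `n = 0`, and a `φ`-equivariant
homomorphism for `n ≥ 1`. -/
def IsTwisted (φ : F.G 0 →* C.G 0) (l : ℕ) : ∀ n, (F.G n → C.G l) → Prop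
  | 0, D => ∀ b b', D (b * b') = C.act l (φ b') (D b) * D b'
  | n + 1, D => (∀ b b', D (b * b') = D b * D b') ∧
      ∀ g b, D (F.act (n + 1) g b) = C.act l (φ g) (D b)

namespace IsTwisted

variable {φ : F.G 0 →* C.G 0} {l n : ℕ}

theorem map_one {D : F.G n → C.G l} (hD : IsTwisted φ l n D) : D 1 = 1 := by
  cases n with
  | zero => simpa [C.act_one] using hD 1 1
  | succ n => simpa using hD.1 1 1

theorem map_inv_zero {D : F.G 0 → C.G l} (hD : IsTwisted φ l 0 D) (b : F.G 0) :
    D b⁻¹ = (C.act l (φ b⁻¹) (D b))⁻¹ := by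
  have h := hD b b⁻¹
  rw [mul_inv_cancel, hD.map_one] at h
  exact (inv_eq_of_mul_eq_one_right h.symm).symm

theorem map_inv_succ {D : F.G (n + 1) → C.G l} (hD : IsTwisted φ l (n + 1) D)
    (b : F.G (n + 1)) : D b⁻¹ = (D b)⁻¹ := by
  have h := hD.1 b b⁻¹
  rw [mul_inv_cancel, hD.map_one] at h
  exact (inv_eq_of_mul_eq_one_right h.symm).symm

theorem δ_comp {D : F.G n → C.G (l + 1)} (hD : IsTwisted φ (l + 1) n D) :
    IsTwisted φ l n fun b => C.δ l (D b) := by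
  cases n with
  | zero => intro b b'; dsimp only; rw [hD, map_mul, C.δ_act]
  | succ n =>
    exact ⟨fun b b' => by dsimp only; rw [hD.1, map_mul],
      fun g b => by dsimp only; rw [hD.2, C.δ_act]⟩

theorem mul (hl : 2 ≤ l) {D E : F.G (n + 1) → C.G l} (hD : IsTwisted φ l (n + 1) D)
    (hE : IsTwisted φ l (n + 1) E) : IsTwisted φ l (n + 1) fun b => D b * E b :=
  ⟨fun b b' => by
    dsimp only
    rw [hD.1, hE.1, (show Commute (D b') (E b) from C.comm' hl _ _).mul_mul_mul_comm],
    fun g b => by dsimp only; rw [hD.2, hE.2, map_mul]⟩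

theorem zpow (hl : 2 ≤ l) {D : F.G (n + 1) → C.G l} (hD : IsTwisted φ l (n + 1) D) (k : ℤ) :
    IsTwisted φ l (n + 1) fun b => D b ^ k :=
  ⟨fun b b' => by
    dsimp only
    rw [hD.1, (show Commute (D b) (D b') from C.comm' hl _ _).mul_zpow],
    fun g b => by dsimp only; rw [hD.2, map_zpow]⟩

theorem inv (hl : 2 ≤ l) {D : F.G (n + 1) → C.G l} (hD : IsTwisted φ l (n + 1) D) :
    IsTwisted φ l (n + 1) fun b => (D b)⁻¹ := by
  simpa using hD.zpow hl (-1)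

theorem comp_δ_succ {D : F.G (n + 1) → C.G l} (hD : IsTwisted φ l (n + 1) D) :
    IsTwisted φ l (n + 2) fun b => D (F.δ (n + 1) b) :=
  ⟨fun b b' => by dsimp only; rw [map_mul, hD.1],
    fun g b => by dsimp only; rw [F.δ_act, hD.2]⟩

/-- In dimensions `≥ 3` of the target, boundaries act trivially, so that a twisted map becomes an
equivariant homomorphism after precomposition with the boundary. -/
theorem comp_δ (hl : 2 ≤ l) (hφ : ∀ b, φ (F.δ 0 b) ∈ (C.δ 0).range) {D : F.G n → C.G l}
    (hD : IsTwisted φ l n D) : IsTwisted φ l (n + 1) fun b => D (F.δ n b) := by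
  have triv : ∀ b a, C.act l (φ (F.δ 0 b)) a = a := fun b a => by
    obtain ⟨c, hc⟩ := hφ b
    rw [← hc, C.act_boundary' hl]
  cases n with
  | zero =>
    refine ⟨fun b b' => by dsimp only; rw [map_mul, hD, triv], fun g b => ?_⟩
    -- expand `D` on both sides of `g * (δ b) ^ g = δ b * g`
    have h : D (g * F.δ 0 (F.act 1 g b)) = D (F.δ 0 b * g) := by
      rw [F.δ_act, F.act_zero]; group
    rw [hD, hD, triv, C.comm' hl] at h
    exact mul_right_cancel h
  | succ n => exact hD.comp_δ_succ

end IsTwisted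

theorem Hom.isTwisted (f : Hom F C) (n : ℕ) :
    IsTwisted (f.map 0) (n + 1) (n + 1) (f.map (n + 1)) :=
  ⟨fun b b' => map_mul _ b b', fun g b => f.map_act _ g b⟩

theorem FoldHomotopy.isTwisted {m : ℕ} {f : Hom F C} (A : FoldHomotopy m f) (n l h) :
    IsTwisted (f.map 0) l n (A.map n l h) := by
  cases n with
  | zero => exact A.map_mul_zero l h
  | succ n => exact ⟨A.map_mul_succ n l h, A.map_act n l h⟩

theorem Hom.map_δ_mem (f : Hom F C) (b : F.G 1) : f.map 0 (F.δ 0 b) ∈ (C.δ 0).range :=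
  ⟨f.map 1 b, (f.map_δ 0 b).symm⟩

/-- The fold homotopy with given twisted components. The degrees of the components are allowed to
be any expressions `d n` equal to `n + m`. -/
def FoldHomotopy.ofTwisted {m : ℕ} {f : Hom F C} (d : ℕ → ℕ) (hd : ∀ n, n + m = d n)
    (D : ∀ n, F.G n → C.G (d n)) (hD : ∀ n, IsTwisted (f.map 0) (d n) n (D n)) :
    FoldHomotopy m f where
  map n l h := ((hd n).symm.trans h) ▸ D n
  map_mul_zero l h := by
    obtain rfl := (hd 0).symm.trans h
    exact hD 0
  map_mul_succ n l h := by
    obtain rfl := (hd (n + 1)).symm.trans h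
    exact (hD (n + 1)).1
  map_act n l h := by
    obtain rfl := (hd (n + 1)).symm.trans h
    exact (hD (n + 1)).2

theorem mk_δ_eq_one (C : ReducedCrossedComplex.{u}) (b : C.G 1) :
    QuotientGroup.mk' (C.δ 0).range (C.δ 0 b) = 1 :=
  (QuotientGroup.eq_one_iff _).2 ⟨b, rfl⟩

/-! ### Consequences of freeness -/

namespace FreeBasis

variable (B : FreeBasis F)

theorem closure_range_ι_zero : Subgroup.closure (Set.range (B.ι 0)) = ⊤ := by
  rw [← FreeGroup.range_lift_eq_closure, MonoidHom.range_eq_top]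
  exact B.free_one.2

theorem exists_hom_zero {P : Type u} [Group P] (v : B.X 0 → P) :
    ∃ ψ : F.G 0 →* P, ∀ x, ψ (B.ι 0 x) = v x := by
  let e := MulEquiv.ofBijective _ B.free_one
  refine ⟨(FreeGroup.lift v).comp e.symm.toMonoidHom, fun x => ?_⟩
  have : e.symm (B.ι 0 x) = FreeGroup.of x := by
    rw [MulEquiv.symm_apply_eq]
    simp [e]
  simp [this]

theorem act_mem_closure (n : ℕ) (g : F.G 0) {b : F.G (n + 1)}
    (hb : b ∈ Subgroup.closure {b | ∃ g x, b = F.act (n + 1) g (B.ι (n + 1) x)}) :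
    F.act (n + 1) g b ∈ Subgroup.closure {b | ∃ g x, b = F.act (n + 1) g (B.ι (n + 1) x)} := by
  have : Subgroup.closure {b | ∃ g x, b = F.act (n + 1) g (B.ι (n + 1) x)} ≤
      (Subgroup.closure {b | ∃ g x, b = F.act (n + 1) g (B.ι (n + 1) x)}).comap
        (F.act (n + 1) g) := by
    rw [Subgroup.closure_le]
    rintro _ ⟨k, x, rfl⟩
    exact Subgroup.subset_closure ⟨k * g, x, (F.act_mul _ _ _ _).symm⟩
  exact this hb

/-- In dimensions `≥ 2`, a free crossed complex is generated by the translates of its basis: the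
subgroup which they generate is stable under the action, so the universal property retracts the
whole group onto it. -/
theorem closure_act_ι (n : ℕ) :
    Subgroup.closure {b | ∃ g x, b = F.act (n + 1) g (B.ι (n + 1) x)} = ⊤ := by
  set N := Subgroup.closure {b | ∃ g x, b = F.act (n + 1) g (B.ι (n + 1) x)} with hN
  have hact : ∀ g, ∀ b ∈ N, F.act (n + 1) g b ∈ N := fun g b hb => B.act_mem_closure n g hb
  have hι : ∀ x, B.ι (n + 1) x ∈ N := fun x =>
    Subgroup.subset_closure ⟨1, x, (F.act_one _ _).symm⟩
  let actN : F.G 0 → N →* N := fun g =>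
    ((F.act (n + 1) g).comp N.subtype).codRestrict N fun b => hact g b b.2
  suffices h : ∃ ψ : F.G (n + 1) →* N, ∀ b, (ψ b : F.G (n + 1)) = b by
    obtain ⟨ψ, hψ⟩ := h
    exact (Subgroup.eq_top_iff' N).2 fun b => hψ b ▸ (ψ b).2
  cases n with
  | zero =>
    obtain ⟨ψ, ⟨h1, h2, h3⟩, -⟩ := B.free_two N (F.G 0) ((F.δ 0).comp N.subtype) actN
      ⟨fun a => Subtype.ext (F.act_one _ _), fun g h a => Subtype.ext (F.act_mul _ _ _ _),
        fun g a => (F.δ_act _ _ _).trans (F.act_zero _ _),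
        fun a b => Subtype.ext (F.peiffer _ _)⟩ (MonoidHom.id _) (fun x => ⟨_, hι x⟩)
      (fun _ => rfl)
    refine ⟨ψ, fun b => ?_⟩
    have hu := (B.free_two (F.G 1) (F.G 0) (F.δ 0) (F.act 1)
      ⟨F.act_one 1, F.act_mul 1, fun g a => (F.δ_act _ _ _).trans (F.act_zero _ _), F.peiffer⟩
      (MonoidHom.id _) (B.ι 1) (fun _ => rfl)).unique
      (y₁ := N.subtype.comp ψ) (y₂ := MonoidHom.id _)
      ⟨h1, fun g b => congrArg Subtype.val (h2 g b), fun x => congrArg Subtype.val (h3 x)⟩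
      ⟨fun _ => rfl, fun _ _ => rfl, fun _ => rfl⟩
    exact DFunLike.congr_fun hu b
  | succ n =>
    let _ : CommGroup (F.G (n + 2)) := { F.grp (n + 2) with mul_comm := F.comm n }
    let _ : CommGroup N :=
      { (inferInstance : Group N) with mul_comm := fun a b => Subtype.ext (F.comm n _ _) }
    have hout : ∀ (g : F.G 0) (a : F.G (n + 2)),
        F.act (n + 2) (Quotient.out (QuotientGroup.mk g : π₁ F)) a = F.act (n + 2) g a := by
      intro g a
      obtain ⟨⟨_, b, rfl⟩, hb⟩ := QuotientGroup.mk_out_eq_mul (F.δ 0).range g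
      rw [hb, F.act_mul, F.act_boundary]
    have hone : ∀ a : F.G (n + 2), F.act (n + 2) (Quotient.out (1 : π₁ F)) a = a := fun a =>
      (hout 1 a).trans (F.act_one _ _)
    have hmul : ∀ (p q : π₁ F) (a : F.G (n + 2)), F.act (n + 2) (Quotient.out (p * q)) a =
        F.act (n + 2) (Quotient.out q) (F.act (n + 2) (Quotient.out p) a) := by
      intro p q a
      induction p using QuotientGroup.induction_on with | H g => ?_
      induction q using QuotientGroup.induction_on with | H h => ?_
      rw [← QuotientGroup.mk_mul, hout, hout, hout, F.act_mul]
    obtain ⟨ψ, ⟨h1, h2⟩, -⟩ := B.free_ge_three n N (fun q => actN q.out)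
      (fun a => Subtype.ext (hone a)) (fun p q a => Subtype.ext (hmul p q a))
      (fun x => ⟨_, hι x⟩)
    refine ⟨ψ, fun b => ?_⟩
    have hu := (B.free_ge_three n (F.G (n + 2)) (fun q => F.act (n + 2) q.out) hone hmul
      (B.ι (n + 2))).unique (y₁ := N.subtype.comp ψ) (y₂ := MonoidHom.id _)
      ⟨fun g b => congrArg Subtype.val (h1 g b), fun x => congrArg Subtype.val (h2 x)⟩
      ⟨fun g b => (hout g b).symm, fun _ => rfl⟩
    exact DFunLike.congr_fun hu b

/-- Twisted maps on a free crossed complex are determined by their values on the basis. -/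
theorem twisted_ext {φ : F.G 0 →* C.G 0} {l n : ℕ} {D E : F.G n → C.G l}
    (hD : IsTwisted φ l n D) (hE : IsTwisted φ l n E)
    (h : ∀ x, D (B.ι n x) = E (B.ι n x)) (b : F.G n) : D b = E b := by
  cases n with
  | zero =>
    have hb : b ∈ Subgroup.closure (Set.range (B.ι 0)) := by simp [B.closure_range_ι_zero]
    induction hb using Subgroup.closure_induction with
    | mem _ hx => obtain ⟨x, rfl⟩ := hx; exact h x
    | one => rw [hD.map_one, hE.map_one]
    | mul a b _ _ ha hb => rw [hD, hE, ha, hb]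
    | inv a _ ha => rw [hD.map_inv_zero, hE.map_inv_zero, ha]
  | succ n =>
    have hb : b ∈ Subgroup.closure {b | ∃ g x, b = F.act (n + 1) g (B.ι (n + 1) x)} := by
      simp [B.closure_act_ι]
    induction hb using Subgroup.closure_induction with
    | mem _ hx => obtain ⟨g, x, rfl⟩ := hx; rw [hD.2, hE.2, h]
    | one => rw [hD.map_one, hE.map_one]
    | mul a b _ _ ha hb => rw [hD.1, hE.1, ha, hb]
    | inv a _ ha => rw [hD.map_inv_succ, hE.map_inv_succ, ha]

/-- On each dimension `≥ 2` of a free crossed complex, equivariant homomorphisms to a `π₁ F`-module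
may be prescribed on the basis. In dimension two the module is regarded as a crossed module over `π₁ F` with trivial boundary. -/
theorem exists_module_hom (n : ℕ) {A : Type u} [CommGroup A] (act : π₁ F → A →* A)
    (act_one : ∀ a, act 1 a = a) (act_mul : ∀ g h a, act (g * h) a = act h (act g a))
    (v : B.X (n + 1) → A) :
    ∃ ψ : F.G (n + 1) →* A,
      (∀ (g : F.G 0) b, ψ (F.act (n + 1) g b) = act (QuotientGroup.mk g) (ψ b)) ∧
        ∀ x, ψ (B.ι (n + 1) x) = v x := by
  cases n with
  | zero =>
    obtain ⟨ψ, ⟨-, h2, h3⟩, -⟩ := B.free_two A (π₁ F) (1 : A →* π₁ F) act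
      ⟨act_one, act_mul, fun g a => by simp, fun a b => by
        rw [MonoidHom.one_apply, act_one, mul_comm b⁻¹, mul_assoc, inv_mul_cancel, mul_one]⟩
      (QuotientGroup.mk' _) v (fun x => (F.mk_δ_eq_one _).symm)
    exact ⟨ψ, h2, h3⟩
  | succ n => exact (B.free_ge_three n A act act_one act_mul v).exists

theorem exists_twisted_succ (φ : F.G 0 →* C.G 0) (hφ : ∀ b, φ (F.δ 0 b) ∈ (C.δ 0).range)
    (n : ℕ) {l : ℕ} (hl : 2 ≤ l) (v : B.X (n + 1) → C.G l) :
    ∃ D : F.G (n + 1) → C.G l, IsTwisted φ l (n + 1) D ∧ ∀ x, D (B.ι (n + 1) x) = v x := by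
  let _ : CommGroup (C.G l) := { C.grp l with mul_comm := C.comm' hl }
  have hout : ∀ (g : F.G 0) (a : C.G l),
      C.act l (φ (Quotient.out (QuotientGroup.mk g : π₁ F))) a = C.act l (φ g) a := by
    intro g a
    obtain ⟨⟨_, b, rfl⟩, hb⟩ := QuotientGroup.mk_out_eq_mul (F.δ 0).range g
    obtain ⟨c, hc⟩ := hφ b
    rw [hb, map_mul, C.act_mul, ← hc, C.act_boundary' hl]
  obtain ⟨ψ, h1, h2⟩ := B.exists_module_hom n (fun q => C.act l (φ q.out))
    (fun a => (hout 1 a).trans (by rw [map_one, C.act_one]))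
    (fun p q a => by
      induction p using QuotientGroup.induction_on with | H g => ?_
      induction q using QuotientGroup.induction_on with | H h => ?_
      rw [← QuotientGroup.mk_mul, hout, hout, hout, map_mul, C.act_mul]) v
  exact ⟨ψ, ⟨map_mul ψ, fun g b => (h1 g b).trans (hout g _)⟩, h2⟩

end FreeBasis

/-- The semidirect product of `C.G 0` with `C.G l`, with product `(p, a) (q, b) = (p q, a ^ q b)`. Its homomorphic sections are the
derivations. -/
@[ext]
structure ActProd (C : ReducedCrossedComplex.{u}) (l : ℕ) where
  fst : C.G 0
  snd : C.G l

namespace ActProd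

variable {l : ℕ}

instance : Mul (ActProd C l) := ⟨fun x y => ⟨x.fst * y.fst, C.act l y.fst x.snd * y.snd⟩⟩
instance : One (ActProd C l) := ⟨⟨1, 1⟩⟩
instance : Inv (ActProd C l) := ⟨fun x => ⟨x.fst⁻¹, (C.act l x.fst⁻¹ x.snd)⁻¹⟩⟩

theorem fst_mul (x y : ActProd C l) : (x * y).fst = x.fst * y.fst := rfl
theorem snd_mul (x y : ActProd C l) : (x * y).snd = C.act l y.fst x.snd * y.snd := rfl
theorem fst_one : (1 : ActProd C l).fst = 1 := rfl
theorem snd_one : (1 : ActProd C l).snd = 1 := rfl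
theorem fst_inv (x : ActProd C l) : x⁻¹.fst = x.fst⁻¹ := rfl
theorem snd_inv (x : ActProd C l) : x⁻¹.snd = (C.act l x.fst⁻¹ x.snd)⁻¹ := rfl

instance : Group (ActProd C l) :=
  Group.ofLeftAxioms
    (fun x y z => by ext <;> simp [fst_mul, snd_mul, mul_assoc, C.act_mul])
    (fun x => by ext <;> simp [fst_mul, snd_mul, fst_one, snd_one])
    (fun x => by
      ext <;> simp [fst_mul, snd_mul, fst_one, snd_one, fst_inv, snd_inv, ← C.act_mul, C.act_one])

/-- The projection to the group in dimension one. -/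
def fstHom : ActProd C l →* C.G 0 := MonoidHom.mk' fst fst_mul

end ActProd

theorem FreeBasis.exists_twisted_zero (B : FreeBasis F) (φ : F.G 0 →* C.G 0) {l : ℕ}
    (v : B.X 0 → C.G l) :
    ∃ D : F.G 0 → C.G l, IsTwisted φ l 0 D ∧ ∀ x, D (B.ι 0 x) = v x := by
  obtain ⟨ψ, hψ⟩ := B.exists_hom_zero fun x => (⟨φ (B.ι 0 x), v x⟩ : ActProd C l)
  have h : ActProd.fstHom.comp ψ = φ := by
    refine MonoidHom.eq_of_eqOn_dense B.closure_range_ι_zero ?_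
    rintro _ ⟨x, rfl⟩
    exact congrArg ActProd.fst (hψ x)
  refine ⟨fun b => (ψ b).snd, fun b b' => ?_, fun x => congrArg ActProd.snd (hψ x)⟩
  dsimp only
  rw [map_mul, ActProd.snd_mul, ← h]
  rfl

/-! ### Lifting through the boundary of an aspherical crossed complex -/

theorem IsAspherical.exists_δ_eq (hC : C.IsAspherical) {n : ℕ} {c : C.G (n + 1)}
    (hc : C.δ n c = 1) : ∃ d, C.δ (n + 1) d = c := by
  have h := QuotientGroup.eq.1
    ((hC n).elim (QuotientGroup.mk 1) (QuotientGroup.mk ⟨c, hc⟩))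
  rwa [inv_one, one_mul] at h

theorem FreeBasis.exists_δ_comp_eq_zero (B : FreeBasis F) {φ : F.G 0 →* C.G 0} {l : ℕ}
    {T : F.G 0 → C.G l} (hT : IsTwisted φ l 0 T) (hr : ∀ b, T b ∈ (C.δ l).range) :
    ∃ D : F.G 0 → C.G (l + 1), IsTwisted φ (l + 1) 0 D ∧ ∀ b, C.δ l (D b) = T b := by
  choose v hv using fun x => hr (B.ι 0 x)
  obtain ⟨D, hD, hDv⟩ := B.exists_twisted_zero φ v
  exact ⟨D, hD, B.twisted_ext hD.δ_comp hT fun x => by rw [hDv, hv]⟩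

theorem FreeBasis.exists_δ_comp_eq_succ (B : FreeBasis F) (hC : C.IsAspherical)
    {φ : F.G 0 →* C.G 0} (hφ : ∀ b, φ (F.δ 0 b) ∈ (C.δ 0).range) {n l : ℕ}
    {T : F.G (n + 1) → C.G (l + 1)} (hT : IsTwisted φ (l + 1) (n + 1) T)
    (hc : ∀ b, C.δ l (T b) = 1) :
    ∃ D : F.G (n + 1) → C.G (l + 2),
      IsTwisted φ (l + 2) (n + 1) D ∧ ∀ b, C.δ (l + 1) (D b) = T b := by
  choose v hv using fun x => hC.exists_δ_eq (hc (B.ι (n + 1) x))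
  obtain ⟨D, hD, hDv⟩ := B.exists_twisted_succ φ hφ n (Nat.le_add_left 2 l) v
  exact ⟨D, hD, B.twisted_ext hD.δ_comp hT fun x => by rw [hDv, hv]⟩

/-- Dependent choice for a sequence in varying types. -/
theorem exists_seq {α : ℕ → Type*} {Q : ∀ n, α n → Prop} {R : ∀ n, α n → α (n + 1) → Prop}
    {a : α 0} (ha : Q 0 a) (h : ∀ n x, Q n x → ∃ y, Q (n + 1) y ∧ R n x y) :
    ∃ s : ∀ n, α n, s 0 = a ∧ (∀ n, Q n (s n)) ∧ ∀ n, R n (s n) (s (n + 1)) := by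
  choose next hQ hR using h
  let t : ∀ n, {x : α n // Q n x} := fun n =>
    Nat.rec ⟨a, ha⟩ (fun n x => ⟨next n x.1 x.2, hQ n x.1 x.2⟩) n
  exact ⟨fun n => (t n).1, rfl, fun n => (t n).2, fun n => hR n _ _⟩

/-! ### Existence of morphisms -/

/-- Every homomorphism `π₁ F → π₁ C` is realised by a morphism. -/
theorem FreeBasis.exists_π₁Map_eq (B : FreeBasis F) (hC : C.IsAspherical) (θ : π₁ F →* π₁ C) :
    ∃ f : Hom F C, f.π₁Map = θ := by
  choose v hv using fun x => QuotientGroup.mk_surjective (θ (QuotientGroup.mk (B.ι 0 x)))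
  obtain ⟨φ, hφv⟩ := B.exists_hom_zero v
  have hθ : (QuotientGroup.mk' (C.δ 0).range).comp φ =
      θ.comp (QuotientGroup.mk' (F.δ 0).range) := by
    refine MonoidHom.eq_of_eqOn_dense B.closure_range_ι_zero ?_
    rintro _ ⟨x, rfl⟩
    simp [hφv, hv]
  have hφ : ∀ b, φ (F.δ 0 b) ∈ (C.δ 0).range := fun b => by
    rw [← QuotientGroup.eq_one_iff]
    have h := DFunLike.congr_fun hθ (F.δ 0 b)
    rw [MonoidHom.comp_apply, MonoidHom.comp_apply, F.mk_δ_eq_one, map_one] at h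
    exact h
  -- in dimension two the universal property of the free crossed module is needed itself, because
  -- the target is not a module
  choose w hw using fun x => hφ (B.ι 1 x)
  obtain ⟨ψ, ⟨h1, h2, -⟩, -⟩ := B.free_two (C.G 1) (C.G 0) (C.δ 0) (C.act 1)
    ⟨C.act_one 1, C.act_mul 1, fun g a => (C.δ_act _ _ _).trans (C.act_zero _ _), C.peiffer⟩
    φ w hw
  obtain ⟨s, hs0, hsQ, hsR⟩ := exists_seq (α := fun n => F.G (n + 1) → C.G (n + 1))
    (Q := fun n D => IsTwisted φ (n + 1) (n + 1) D ∧ ∀ b, C.δ n (D (F.δ (n + 1) b)) = 1)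
    (R := fun n D E => ∀ b, D (F.δ (n + 1) b) = C.δ (n + 1) (E b)) (a := ψ)
    ⟨⟨map_mul ψ, h2⟩, fun b => by rw [h1, F.δ_δ, map_one]⟩ (by
      rintro n D ⟨hD, hc⟩
      obtain ⟨E, hE, hδ⟩ := B.exists_δ_comp_eq_succ hC hφ hD.comp_δ_succ hc
      exact ⟨E, ⟨hE, fun b => by rw [hδ, F.δ_δ, hD.map_one]⟩, fun b => (hδ b).symm⟩)
  refine ⟨⟨fun | 0 => φ | n + 1 => MonoidHom.mk' (s n) (hsQ n).1.1, ?_, ?_⟩, ?_⟩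
  · rintro (_ | n) a
    · change φ (F.δ 0 a) = C.δ 0 (s 0 a)
      rw [hs0, h1]
    · exact hsR n a
  · rintro (_ | n) g a
    · change φ _ = C.act 0 (φ g) (φ a)
      simp [F.act_zero, C.act_zero]
    · exact (hsQ n).1.2 g a
  · apply QuotientGroup.monoidHom_ext
    exact hθ

/-! ### Existence of homotopies -/

/-- The obstruction to extending a homotopy from `f` to `g`, given by a derivation `D` in
dimension one, to dimension two. Its values are cycles and hence central, which makes it a
homomorphism although `C` need not be abelian in dimension two. -/
theorem isTwisted_obstruction_one {f g : Hom F C} {D : F.G 0 → C.G 1}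
    (hD : IsTwisted (g.map 0) 1 0 D) (hfg : ∀ b, C.δ 0 (D b) = (g.map 0 b)⁻¹ * f.map 0 b) :
    (∀ b, C.δ 0 ((g.map 1 b * D (F.δ 0 b))⁻¹ * f.map 1 b) = 1) ∧
    IsTwisted (g.map 0) 1 1 fun b => (g.map 1 b * D (F.δ 0 b))⁻¹ * f.map 1 b := by
  have hcyc : ∀ b, C.δ 0 ((g.map 1 b * D (F.δ 0 b))⁻¹ * f.map 1 b) = 1 := fun b => by
    rw [map_mul, map_inv, map_mul, ← g.map_δ, ← f.map_δ, hfg]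
    group
  have hcen : ∀ z : C.G 1, C.δ 0 z = 1 → ∀ a, a * z = z * a := fun z hz a => by
    have h := C.peiffer a z
    rw [hz, C.act_one] at h
    calc a * z = z * (z⁻¹ * a * z) := by group
      _ = z * a := by rw [← h]
  refine ⟨hcyc, fun b b' => ?_, fun a b => ?_⟩
  · dsimp only
    have hk : g.map 1 (b * b') * D (F.δ 0 (b * b')) =
        (g.map 1 b * D (F.δ 0 b)) * (g.map 1 b' * D (F.δ 0 b')) := by
      rw [map_mul, map_mul, hD, g.map_δ, C.peiffer]
      group
    have h := hcen _ (hcyc b) (g.map 1 b' * D (F.δ 0 b'))⁻¹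
    rw [hk, map_mul (f.map 1), mul_inv_rev, mul_assoc, ← mul_assoc _ (f.map 1 b), ← mul_assoc, h,
      mul_assoc]
  · dsimp only
    -- both `g b * D (δ b)` and `f b` are transformed by `a` followed by conjugation with `D a`
    have hk : g.map 1 (F.act 1 a b) * D (F.δ 0 (F.act 1 a b)) =
        (D a)⁻¹ * C.act 1 (g.map 0 a) (g.map 1 b * D (F.δ 0 b)) * D a := by
      have h : D (a * F.δ 0 (F.act 1 a b)) = D (F.δ 0 b * a) := by
        rw [F.δ_act, F.act_zero]; group
      rw [hD, hD, g.map_δ, C.peiffer] at h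
      rw [map_mul, ← g.map_act, mul_assoc, mul_assoc, ← h]
      group
    have hf : f.map 1 (F.act 1 a b) = (D a)⁻¹ * C.act 1 (g.map 0 a) (f.map 1 b) * D a := by
      have h : f.map 0 a = g.map 0 a * C.δ 0 (D a) := by rw [hfg]; group
      rw [f.map_act, h, C.act_mul, C.peiffer]
    have hz := hcen (C.act 1 (g.map 0 a) ((g.map 1 b * D (F.δ 0 b))⁻¹ * f.map 1 b))
      (by rw [C.δ_act, hcyc, map_one]) (D a)⁻¹
    calc (g.map 1 (F.act 1 a b) * D (F.δ 0 (F.act 1 a b)))⁻¹ * f.map 1 (F.act 1 a b)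
        = (D a)⁻¹ * C.act 1 (g.map 0 a) ((g.map 1 b * D (F.δ 0 b))⁻¹ * f.map 1 b) * D a := by
          rw [hk, hf, map_mul (C.act 1 (g.map 0 a)) (_)⁻¹, map_inv]; group
      _ = _ := by rw [hz]; group

/-- Morphisms from a free to an aspherical crossed complex which induce the same homomorphism of
fundamental groups are homotopic. -/
theorem FreeBasis.exists_homotopy (B : FreeBasis F) (hC : C.IsAspherical) {f g : Hom F C}
    (h : f.π₁Map = g.π₁Map) : Nonempty (Homotopy f g) := by
  have hr : ∀ b, (g.map 0 b)⁻¹ * f.map 0 b ∈ (C.δ 0).range := fun b =>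
    QuotientGroup.eq.1 (DFunLike.congr_fun h (QuotientGroup.mk b)).symm
  have hT : IsTwisted (g.map 0) 0 0 fun b => (g.map 0 b)⁻¹ * f.map 0 b := fun b b' => by
    simp only [map_mul, C.act_zero]
    group
  obtain ⟨D₀, hD₀, hδ₀⟩ := B.exists_δ_comp_eq_zero hT hr
  have hact : ∀ {l : ℕ}, 2 ≤ l → ∀ b (c : C.G l), C.act l (f.map 0 b) c =
      C.act l (g.map 0 b) c := fun hl b c => by
    obtain ⟨d, hd⟩ := hr b
    rw [← mul_inv_cancel_left (g.map 0 b) (f.map 0 b), ← hd, C.act_mul, C.act_boundary' hl]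
  -- the invariant records the homotopy equation only on boundaries, where it does not involve the
  -- previous component, and on everything in dimension one
  obtain ⟨s, hs0, hsQ, hsR⟩ := exists_seq (α := fun n => F.G n → C.G (n + 1))
    (Q := fun n D => IsTwisted (g.map 0) (n + 1) n D ∧
      (∀ b, C.δ n (D (F.δ n b)) = (g.map n (F.δ n b))⁻¹ * f.map n (F.δ n b)) ∧
        (n = 0 → ∀ b, C.δ n (D b) = (g.map n b)⁻¹ * f.map n b))
    (R := fun n D E => ∀ b, C.δ (n + 1) (E b) =
      (g.map (n + 1) b * D (F.δ n b))⁻¹ * f.map (n + 1) b) (a := D₀)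
    ⟨hD₀, fun b => hδ₀ _, fun _ => hδ₀⟩ (by
      rintro n D ⟨hD, hc, hc₀⟩
      have key : (∀ b, C.δ n ((g.map (n + 1) b * D (F.δ n b))⁻¹ * f.map (n + 1) b) = 1) ∧
          IsTwisted (g.map 0) (n + 1) (n + 1)
            fun b => (g.map (n + 1) b * D (F.δ n b))⁻¹ * f.map (n + 1) b := by
        cases n with
        | zero => exact isTwisted_obstruction_one hD (hc₀ rfl)
        | succ n =>
          refine ⟨fun b => ?_, ?_⟩
          · rw [map_mul, map_inv, map_mul, ← g.map_δ, ← f.map_δ, hc]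
            group
          · exact IsTwisted.mul (by omega) (IsTwisted.inv (by omega)
              (IsTwisted.mul (by omega) (g.isTwisted _) (hD.comp_δ (by omega) g.map_δ_mem)))
              ⟨fun b b' => map_mul _ b b', fun a b => by
                rw [f.map_act, hact (by omega)]⟩
      obtain ⟨E, hE, hδ⟩ := B.exists_δ_comp_eq_succ hC g.map_δ_mem key.2 key.1
      refine ⟨E, ⟨hE, fun b => ?_, by omega⟩, hδ⟩
      rw [hδ, F.δ_δ, hD.map_one, mul_one])
  refine ⟨⟨FoldHomotopy.ofTwisted (fun n => n + 1) (fun _ => rfl) s fun n => (hsQ n).1, ?_⟩⟩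
  rintro (_ | n) b
  · change f.map 0 b = g.map 0 b * C.δ 0 (s 0 b)
    rw [hs0, hδ₀]; group
  · change f.map (n + 1) b = g.map (n + 1) b * s n (F.δ n b) * C.δ (n + 1) (s (n + 1) b)
    rw [hsR]; group

/-- Over a free source and with an aspherical target, every fold homotopy which is a cycle is a
boundary. -/
theorem FreeBasis.exists_boundary_eq (B : FreeBasis F) (hC : C.IsAspherical) {f : Hom F C}
    {m : ℕ} (A : FoldHomotopy (m + 1) f) (hA : ∀ n l h b, A.boundaryMap n l h b = 1) :
    ∃ E : FoldHomotopy (m + 2) f, E.boundary = A := by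
  have hm : ∀ n, n + (m + 1) = m + n + 1 := fun n => by omega
  obtain ⟨D₀, hD₀, hδ₀⟩ := B.exists_δ_comp_eq_zero (A.isTwisted 0 (m + 1) (hm 0)) fun b =>
    hC.exists_δ_eq (hA 0 m (by omega) b)
  -- degrees are written `m + n + 2` because this reduces when `n` is a successor
  obtain ⟨s, hs0, hsQ, hsR⟩ := exists_seq (α := fun n => F.G n → C.G (m + n + 2))
    (Q := fun n D => IsTwisted (f.map 0) (m + n + 2) n D ∧
      ∀ b, C.δ (m + n + 1) (D (F.δ n b)) = A.map n (m + n + 1) (hm n) (F.δ n b))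
    (R := fun n D E => ∀ b, C.δ (m + n + 2) (E b) = A.map (n + 1) (m + n + 2) (hm (n + 1)) b *
      D (F.δ n b) ^ (-(-1 : ℤ) ^ (m + 3))) (a := D₀)
    ⟨hD₀, fun b => hδ₀ _⟩ (by
      rintro n D ⟨hD, hc⟩
      have hT : IsTwisted (f.map 0) (m + n + 2) (n + 1) fun b =>
          A.map (n + 1) (m + n + 2) (hm (n + 1)) b * D (F.δ n b) ^ (-(-1 : ℤ) ^ (m + 3)) :=
        (A.isTwisted _ _ _).mul (by omega)
          ((hD.comp_δ (by omega) f.map_δ_mem).zpow (by omega) _)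
      obtain ⟨E, hE, hδ⟩ := B.exists_δ_comp_eq_succ hC f.map_δ_mem hT fun b => by
        rw [map_mul, map_zpow, hc]
        have h := hA (n + 1) (m + n + 1) (by omega) b
        simp only [FoldHomotopy.boundaryMap] at h
        rw [← h, pow_succ, mul_neg_one, neg_neg]
      refine ⟨E, ⟨hE, fun b => ?_⟩, hδ⟩
      refine (hδ _).trans ?_
      rw [F.δ_δ, hD.map_one, one_zpow, mul_one]
      rfl)
  refine ⟨FoldHomotopy.ofTwisted (fun n => m + n + 2) (fun n => by omega) s
    fun n => (hsQ n).1, FoldHomotopy.ext' ?_⟩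
  intro n l hl b
  obtain rfl : l = m + n + 1 := by omega
  cases n with
  | zero =>
    change C.δ (m + 1) (s 0 b) = _
    rw [hs0, hδ₀]
  | succ n =>
    change C.δ (m + n + 2) (s (n + 1) b) * s n (F.δ n b) ^ ((-1 : ℤ) ^ (m + 3)) = _
    rw [hsR, mul_assoc, ← zpow_add, neg_add_cancel, zpow_zero, mul_one]
    rfl

/-! ### Morphisms to `K(G, 1)` -/

theorem toπ₁Hom_bijective (F : ReducedCrossedComplex.{u}) (G : Type u) [Group G] :
    Function.Bijective (HomotopyClasses.toπ₁Hom F G) := by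
  constructor
  · intro x y h
    induction x using Quotient.inductionOn with | h f => ?_
    induction y using Quotient.inductionOn with | h g => ?_
    have hfg : f = g := by
      refine Hom.ext (funext fun n => MonoidHom.ext fun b => ?_)
      cases n with
      | zero => exact DFunLike.congr_fun h (QuotientGroup.mk b)
      | succ n => exact Subsingleton.elim _ _
    rw [hfg]
  · intro θ
    refine ⟨homotopyClass ⟨fun
      | 0 => (θ.comp (QuotientGroup.mk' _) : F.G 0 →* G)
      | _ + 1 => 1, ?_, ?_⟩, ?_⟩
    · rintro (_ | n) a
      · change θ (QuotientGroup.mk' (F.δ 0).range (F.δ 0 a)) = 1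
        rw [F.mk_δ_eq_one, map_one]
      · exact Subsingleton.elim _ _
    · rintro (_ | n) g a
      · rw [F.act_zero, (K G).act_zero, map_mul, map_mul, map_inv]
      · exact Subsingleton.elim _ _
    · apply QuotientGroup.monoidHom_ext
      rfl

theorem toπ₁Hom_postcomp_toK (f : Hom F C) : HomotopyClasses.toπ₁Hom F (π₁ C)
    (HomotopyClasses.postcomp F C.toK (homotopyClass f)) = f.π₁Map := by
  apply QuotientGroup.monoidHom_ext
  rfl

theorem subsingleton_π_CRS (hF : F.IsFree) (hC : C.IsAspherical) (f : (CRS F C).Obj) (n : ℕ) :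
    Subsingleton ((CRS F C).π (n + 1) f) := by
  obtain ⟨B⟩ := hF
  -- each of these groups is a quotient by a subgroup, which is shown to be everything
  have quot : ∀ {H : Type u} [Group H] (N : Subgroup H), (∀ A, A ∈ N) → Subsingleton (H ⧸ N) :=
    fun N h => by
      rw [(Subgroup.eq_top_iff' N).2 h]
      exact QuotientGroup.subsingleton_quotient_top
  match n with
  | 0 =>
    let _ := Groupoid.vertexGroup f
    refine quot ((CRS F C).δ₂Hom f).range fun (A : Homotopy (F := F) (C := C) f f) => ?_
    obtain ⟨E, hE⟩ := B.exists_boundary_eq hC (m := 0) A.toFold fun n l h b => by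
      obtain rfl : l = n := by omega
      cases l with
      | zero => simpa [FoldHomotopy.boundaryMap] using A.source_zero b
      | succ n =>
        have h := A.source_succ n b
        rw [mul_assoc, left_eq_mul, ← C.δ_central] at h
        simpa [FoldHomotopy.boundaryMap] using h
    exact ⟨E, Homotopy.ext' fun n l hl b => by rw [← hE]; rfl⟩
  | 1 =>
    let _ := Groupoid.vertexGroup f
    refine quot (((CRS F C).δ 0 f).range.subgroupOf ((CRS F C).δ₂Hom f).ker) ?_
    rintro ⟨A, hA⟩
    exact B.exists_boundary_eq hC (m := 1) A fun n l h b =>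
      congrArg (fun H : Homotopy (F := F) (C := C) f f => H.toFold.map n l h b) hA
  | m + 2 =>
    refine quot (((CRS F C).δ (m + 1) f).range.subgroupOf ((CRS F C).δ m f).ker) ?_
    rintro ⟨A, hA⟩
    exact B.exists_boundary_eq hC (m := m + 2) A fun n l h b =>
      congrArg (fun H : FoldHomotopy (F := F) (C := C) (m + 2) f => H.map n l h b) hA

end ReducedCrossedComplex

open ReducedCrossedComplex in
theorem proposition2p9 (F C : ReducedCrossedComplex.{u}) (hF : F.IsFree) (hC : C.IsAspherical) :
    Function.Bijective (HomotopyClasses.postcomp F C.toK) ∧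
    Function.Bijective (HomotopyClasses.toπ₁Hom F (π₁ C)) ∧
    (∀ f : Hom F C, HomotopyClasses.toπ₁Hom F (π₁ C)
      (HomotopyClasses.postcomp F C.toK (homotopyClass f)) = f.π₁Map) ∧
    ∀ (f : Hom F C) (n : ℕ), 1 ≤ n → Subsingleton ((CRS F C).π n f) := by
  have hK := toπ₁Hom_bijective F (π₁ C)
  refine ⟨(Function.Bijective.of_comp_iff' hK _).1 ⟨fun x y h => ?_, fun θ => ?_⟩, hK,
    toπ₁Hom_postcomp_toK, fun f n hn => ?_⟩
  · induction x using Quotient.inductionOn with | h f => ?_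
    induction y using Quotient.inductionOn with | h g => ?_
    obtain ⟨B⟩ := hF
    refine Quotient.sound (B.exists_homotopy hC ?_)
    rw [← toπ₁Hom_postcomp_toK f, ← toπ₁Hom_postcomp_toK g]
    exact h
  · obtain ⟨B⟩ := hF
    obtain ⟨f, hf⟩ := B.exists_π₁Map_eq hC θ
    exact ⟨homotopyClass f, (toπ₁Hom_postcomp_toK f).trans hf⟩
  · obtain ⟨n, rfl⟩ := Nat.exists_eq_add_of_le' hn
    exact subsingleton_π_CRS hF hC f n
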